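/- Let $d\in\mathbb{N}$ and let $\mu$ be a compactly supported Borel probability measure on $\mathbb{R}^d$ with support $\operatorname{spt}\mu$. Let $\underline{V}=(V_k)_{k=1}^\infty$ be a sequence of open subsets of $\mathbb{R}^d$ such that $0\in V_k$ for every $k$ and $\operatorname{diam} V_k\to 0$ as $k\to\infty$. Let $\Omega=(\operatorname{spt}\mu)^{\mathbb{N}}$ be equipped with the product measure $\mathbb{P}=\mu^{\mathbb{N}}$, and for $\omega=(\omega_k)_{k=1}^\infty\in\Omega$ let $$E_{\underline{V}}(\omega)=\limsup_{k\to\infty}(\omega_k+V_k)=\bigcap_{n=1}^\infty\bigcup_{k=n}^\infty(\omega_k+V_k).$$ Assume that $A\subset\mathbb{R}^d$ is an analytic set (that is, $A$ is empty or a continuous image of $\mathbb{N}^{\mathbb{N}}$) such that $A\cap E_{\underline{V}}(\omega)\neq\emptyset$ for $\mathbb{P}$-almost every $\omega\in\Omega$. Then there exists a compact set $C\subset A$ such that $C\cap E_{\underline{V}}(\omega)\neq\emptyset$ for $\mathbb{P}$-almost every $\omega\in\Omega$. -/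

import Mathlib

open MeasureTheory Filter Topology

noncomputable section

namespace RandomCovering

/-- `ℝ^d` with the Euclidean norm. -/
abbrev E (d : ℕ) : Type := EuclideanSpace ℝ (Fin d)

/-- `μ` is a compactly supported Borel probability measure on `ℝ^d`. -/
structure IsCompactlySupportedProbability {d : ℕ} (μ : Measure (E d)) : Prop where
  isProbabilityMeasure : IsProbabilityMeasure μ
  isCompact_support : IsCompact μ.support

/-- The sample space `Ω = (spt μ)^ℕ`. -/
abbrev Omega {d : ℕ} (μ : Measure (E d)) : Type := ℕ → μ.support

/-- The measure `μ`, regarded as a Borel measure on the subspace `spt μ`. -/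
def onSupport {d : ℕ} (μ : Measure (E d)) : Measure μ.support :=
  μ.comap Subtype.val

/-- The infinite product measure `ℙ = μ^ℕ` on `Ω = (spt μ)^ℕ`. -/
def law {d : ℕ} (μ : Measure (E d)) : Measure (Omega μ) :=
  Measure.infinitePi fun _ : ℕ => onSupport μ

/-- A sequence of open sets is admissible if every set contains the origin and the diameters
tend to `0`. The diameter takes values in `[0, ∞]`, so unbounded sets have diameter `∞`. -/
structure Admissible {d : ℕ} (V : ℕ → Set (E d)) : Prop where
  isOpen : ∀ k, IsOpen (V k)
  zero_mem : ∀ k, (0 : E d) ∈ V k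
  tendsto_diam : Tendsto (fun k => Metric.ediam (V k)) atTop (𝓝 0)

/-- The random covering set `E_V(ω) = limsup_k (ω_k + V_k) = ⋂_n ⋃_{k ≥ n} (ω_k + V_k)`. -/
def coveringSet {d : ℕ} {μ : Measure (E d)} (V : ℕ → Set (E d)) (ω : Omega μ) : Set (E d) :=
  ⋂ n : ℕ, ⋃ k ≥ n, (fun v : E d => (ω k : E d) + v) '' V k

/-- `μ` is carried by its support, so it induces a probability measure there; hence `law μ`
is a genuine product measure. -/
theorem isProbabilityMeasure_onSupport {d : ℕ} (μ : Measure (E d)) [IsProbabilityMeasure μ] :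
    IsProbabilityMeasure (onSupport μ) := by
  refine (MeasurableEmbedding.subtype_coe
    Measure.isClosed_support.measurableSet).isProbabilityMeasure_comap ?_
  rw [Subtype.range_coe]
  exact Measure.support_mem_ae

/-- The law of the sequence of random centres is a probability measure. -/
theorem isProbabilityMeasure_law {d : ℕ} (μ : Measure (E d)) [IsProbabilityMeasure μ] :
    IsProbabilityMeasure (law μ) := by
  haveI := isProbabilityMeasure_onSupport μ
  unfold law
  infer_instance

end RandomCovering

end

namespace RandomCovering

open Set

/-! The pairs `(ω, x)` with `x ∈ A ∩ coveringSet V ω` form an analytic set, hence a continuous image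
of Baire space under some `g`. Its projection to `Ω` has full measure, so a capacity argument
(`exists_isCompact_measure_image_pos`) gives a compact `K` whose projected image still has positive
measure. The `x`-coordinates of `g '' K` form `C`, which is hit with positive probability. Hitting a
fixed set is invariant under finite changes of `ω`, so the zero-one law (`ae_mem_of_tail_invariant`)
makes the hit almost sure. -/

/-- Boxes in Baire space are compact. -/
theorem isCompact_box (N : ℕ → ℕ) : IsCompact {σ : ℕ → ℕ | ∀ i, σ i ≤ N i} := by
  have := isCompact_univ_pi fun i => (Set.finite_Iic (N i)).isCompact
  convert this using 1
  ext σ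
  simp [Pi.le_def]

/-- A sequence of closures of images of boxes which constrain more and more coordinates
decreases to a subset of the image of the full box. -/
theorem iInter_closure_image_boxes_subset {X : Type*} [TopologicalSpace X]
    [TopologicalSpace.MetrizableSpace X] {h : (ℕ → ℕ) → X} (hh : Continuous h) (N : ℕ → ℕ) :
    ⋂ k, closure (h '' {σ | ∀ i < k, σ i ≤ N i}) ⊆ h '' {σ | ∀ i, σ i ≤ N i} := by
  let _ := TopologicalSpace.metrizableSpaceMetric X
  intro x hx
  have approx : ∀ k : ℕ, ∃ σ : ℕ → ℕ, (∀ i < k, σ i ≤ N i) ∧ dist x (h σ) < 1 / ((k : ℝ) + 1) := by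
    intro k
    obtain ⟨_, ⟨σ, hσ, rfl⟩, hd⟩ :=
      Metric.mem_closure_iff.1 (mem_iInter.1 hx k) (1 / ((k : ℝ) + 1)) (by positivity)
    exact ⟨σ, hσ, hd⟩
  choose σ hσ hd using approx
  -- Truncation by `N` moves `σ k` into the compact box without altering its first `k` coordinates,
  -- so both sequences have the same subsequential limit.
  obtain ⟨τ, hτ, φ, hφ, hlim⟩ := (isCompact_box N).tendsto_subseq (x := fun k i => min (σ k i) (N i))
    (fun k i => min_le_right _ _)
  have hσlim : Tendsto (σ ∘ φ) atTop (𝓝 τ) := by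
    rw [tendsto_pi_nhds] at hlim ⊢
    intro i
    refine (hlim i).congr' ?_
    filter_upwards [eventually_gt_atTop i] with k hk
    exact min_eq_left (hσ _ i (hk.trans_le (hφ.id_le k)))
  have hx1 : Tendsto (fun k => h (σ k)) atTop (𝓝 x) := by
    rw [tendsto_iff_dist_tendsto_zero]
    refine squeeze_zero (fun _ => dist_nonneg) (fun k => ?_) tendsto_one_div_add_atTop_nhds_zero_nat
    rw [dist_comm]
    exact (hd k).le
  exact ⟨τ, hτ, tendsto_nhds_unique ((hh.tendsto τ).comp hσlim) (hx1.comp hφ.tendsto_atTop)⟩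

/-- A continuous image of Baire space of positive outer measure contains the image of a compact
set of positive measure. -/
theorem exists_isCompact_measure_image_pos {X : Type*} [TopologicalSpace X]
    [TopologicalSpace.MetrizableSpace X] [MeasurableSpace X] [OpensMeasurableSpace X]
    (P : Measure X) [IsFiniteMeasure P] {h : (ℕ → ℕ) → X} (hh : Continuous h)
    (hpos : P (range h) ≠ 0) :
    ∃ K : Set (ℕ → ℕ), IsCompact K ∧ P (h '' K) ≠ 0 := by
  obtain ⟨c, hc0, hc⟩ := exists_between (pos_iff_ne_zero.2 hpos)
  have step : ∀ (S : Set (ℕ → ℕ)) (k : ℕ), ∃ m : ℕ, c < P (h '' S) →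
      c < P (h '' (S ∩ {σ | σ k ≤ m})) := by
    intro S k
    by_cases hS : c < P (h '' S)
    · have hmono : Monotone fun m : ℕ => h '' (S ∩ {σ | σ k ≤ m}) := fun a b hab =>
        image_mono (inter_subset_inter_right _ fun σ (hσ : σ k ≤ a) => hσ.trans hab)
      have hU : h '' S = ⋃ m : ℕ, h '' (S ∩ {σ | σ k ≤ m}) := by
        rw [← image_iUnion, ← inter_iUnion]
        congr 1
        refine (inter_eq_left.2 fun σ _ => mem_iUnion.2 ⟨σ k, le_refl (σ k)⟩).symm
      -- Continuity from below holds for outer measure, so the images need not be measurable.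
      rw [hU, hmono.measure_iUnion] at hS
      obtain ⟨m, hm⟩ := lt_iSup_iff.1 hS
      exact ⟨m, fun _ => hm⟩
    · exact ⟨0, fun h' => absurd h' hS⟩
  choose m hm using step
  let S : ℕ → Set (ℕ → ℕ) := fun k => Nat.rec univ (fun k T => T ∩ {σ | σ k ≤ m T k}) k
  have hSc : ∀ k, c < P (h '' S k) := by
    intro k
    induction k with
    | zero => simpa [S] using hc
    | succ k ih => exact hm _ _ ih
  let N : ℕ → ℕ := fun k => m (S k) k
  have hS : ∀ k, S k = {σ | ∀ i < k, σ i ≤ N i} := by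
    intro k
    induction k with
    | zero => simp [S]
    | succ k ih =>
      change S k ∩ {σ | σ k ≤ N k} = _
      rw [ih]
      ext σ
      exact Nat.forall_lt_succ_right.symm
  refine ⟨{σ | ∀ i, σ i ≤ N i}, isCompact_box N, ?_⟩
  -- Continuity from above does need measurability, hence the closures.
  · have hanti : Antitone fun k : ℕ => closure (h '' {σ | ∀ i < k, σ i ≤ N i}) := fun a b hab =>
      closure_mono (image_mono fun σ hσ i hi => hσ i (hi.trans_le hab))
    have hlim := tendsto_measure_iInter_atTop (μ := P)
      (fun k => isClosed_closure.measurableSet.nullMeasurableSet) hanti ⟨0, measure_ne_top _ _⟩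
    have hle : c ≤ P (⋂ k, closure (h '' {σ | ∀ i < k, σ i ≤ N i})) := by
      refine ge_of_tendsto hlim (Eventually.of_forall fun k => ?_)
      have := hSc k
      rw [hS k] at this
      exact this.le.trans (measure_mono subset_closure)
    exact (hc0.trans_le
      (hle.trans (measure_mono (iInter_closure_image_boxes_subset hh N)))).ne'

/-- A set of sequences which is invariant under changing finitely many coordinates, and which
contains a compact set of positive product measure, has full measure. -/
theorem ae_mem_of_tail_invariant {X : Type*} [TopologicalSpace X] [T2Space X]
    [SecondCountableTopology X] [MeasurableSpace X] [BorelSpace X]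
    (P : Measure X) [IsProbabilityMeasure P] {F T : Set (ℕ → X)} (hF : IsCompact F)
    (hFpos : Measure.infinitePi (fun _ : ℕ => P) F ≠ 0) (hFT : F ⊆ T)
    (hT : ∀ (n : ℕ) (ω ω' : ℕ → X), (∀ k, ω (k + n) = ω' (k + n)) → ω ∈ T → ω' ∈ T) :
    ∀ᵐ ω ∂(Measure.infinitePi fun _ : ℕ => P), ω ∈ T := by
  let s : ℕ → (ℕ → X) → (ℕ → X) := fun n ω k => ω (k + n)
  have hs : ∀ n, Continuous (s n) := fun n => by fun_prop
  -- `G n` consists of the sequences agreeing with a point of `F` from index `n` on. The union of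
  -- the `G n` is a measurable tail event between `F` and `T`; `T` itself may be nonmeasurable.
  let G : ℕ → Set (ℕ → X) := fun n => s n ⁻¹' (s n '' F)
  have hG : Monotone G := by
    refine monotone_nat_of_le_succ fun n ω => ?_
    rintro ⟨ω', hω', he⟩
    refine ⟨ω', hω', funext fun k => ?_⟩
    have := congrFun he (k + 1)
    simpa [s, add_assoc, add_comm, add_left_comm] using this
  let 𝓕 : ℕ → MeasurableSpace (ℕ → X) := fun k =>
    MeasurableSpace.comap (fun ω => ω k) inferInstance
  have h_le : ∀ k, 𝓕 k ≤ MeasurableSpace.pi := fun k => (measurable_pi_apply k).comap_le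
  have hind : ProbabilityTheory.iIndep 𝓕 (Measure.infinitePi fun _ : ℕ => P) :=
    ProbabilityTheory.iIndepFun_infinitePi (P := fun _ : ℕ => P) (X := fun _ x => x)
      (fun _ => measurable_id)
  have hGn : ∀ j n, j ≤ n → MeasurableSet[⨆ k ≥ j, 𝓕 k] (G n) := by
    intro j n hjn
    have hmeas : @Measurable _ _ (⨆ k ≥ j, 𝓕 k) _ (s n) := by
      refine @measurable_pi_lambda _ _ _ (⨆ k ≥ j, 𝓕 k) _ _ fun k => ?_
      exact (comap_measurable _).mono (le_iSup₂_of_le (k + n) (by omega) le_rfl) le_rfl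
    exact hmeas (hF.image (hs n)).isClosed.measurableSet
  have htail : MeasurableSet[limsup 𝓕 atTop] (⋃ n, G n) := by
    rw [limsup_eq_iInf_iSup_of_nat, MeasurableSpace.measurableSet_iInf]
    intro j
    have : ⋃ n, G n = ⋃ n, G (n + j) := (hG.iUnion_nat_add j).symm
    rw [this]
    exact @MeasurableSet.iUnion _ _ (⨆ k ≥ j, 𝓕 k) _ _ fun n => hGn j (n + j) (by omega)
  have hpos : Measure.infinitePi (fun _ : ℕ => P) (⋃ n, G n) ≠ 0 := fun h0 =>
    hFpos (measure_mono_null ((subset_preimage_image (s 0) F).trans (subset_iUnion G 0)) h0)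
  have hone := (ProbabilityTheory.measure_zero_or_one_of_measurableSet_limsup_atTop h_le hind
    htail).resolve_left hpos
  have hm : MeasurableSet (⋃ n, G n) := MeasurableSet.iUnion fun n =>
    (((hF.image (hs n)).isClosed).preimage (hs n)).measurableSet
  filter_upwards [(mem_ae_iff_prob_eq_one hm).2 hone] with ω hω
  obtain ⟨n, ω', hω', he⟩ := mem_iUnion.1 hω
  exact hT n ω' ω (fun k => congrFun he k) (hFT hω')

theorem mem_coveringSet {d : ℕ} {μ : Measure (E d)} {V : ℕ → Set (E d)} {ω : Omega μ} {x : E d} :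
    x ∈ coveringSet V ω ↔ ∀ n : ℕ, ∃ k ≥ n, x - ω k ∈ V k := by
  simp only [coveringSet, mem_iInter, mem_iUnion, exists_prop, mem_image]
  refine forall_congr' fun n => exists_congr fun k => and_congr_right fun _ => ⟨?_, fun h => ?_⟩
  · rintro ⟨v, hv, rfl⟩
    simpa using hv
  · exact ⟨_, h, by abel⟩

/-- The covering set does not depend on finitely many of the centres. -/
theorem coveringSet_subset_of_tail_eq {d : ℕ} {μ : Measure (E d)} (V : ℕ → Set (E d)) (n : ℕ)
    {ω ω' : Omega μ} (h : ∀ k, ω (k + n) = ω' (k + n)) : coveringSet V ω ⊆ coveringSet V ω' := by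
  intro x hx
  rw [mem_coveringSet] at hx ⊢
  intro j
  obtain ⟨k, hk, hxk⟩ := hx (max j n)
  have hkn := h (k - n)
  rw [Nat.sub_add_cancel ((le_max_right j n).trans hk)] at hkn
  exact ⟨k, (le_max_left j n).trans hk, hkn ▸ hxk⟩

/-- Makes the graph Borel, hence analytic in a Polish product. -/
theorem isGδ_graph_coveringSet {d : ℕ} {μ : Measure (E d)} {V : ℕ → Set (E d)}
    (hV : ∀ k, IsOpen (V k)) : IsGδ {p : Omega μ × E d | p.2 ∈ coveringSet V p.1} := by
  have : {p : Omega μ × E d | p.2 ∈ coveringSet V p.1} =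
      ⋂ n : ℕ, ⋃ k ≥ n, (fun p : Omega μ × E d => p.2 - (p.1 k : E d)) ⁻¹' V k := by
    ext p
    simp [mem_coveringSet]
  rw [this]
  exact IsGδ.iInter_of_isOpen fun n => isOpen_iUnion fun k => isOpen_iUnion fun _ =>
    (hV k).preimage (by fun_prop)

end RandomCovering

theorem mainTheorem8 (d : ℕ) (μ : Measure (RandomCovering.E d))
    (hμ : RandomCovering.IsCompactlySupportedProbability μ)
    (V : ℕ → Set (RandomCovering.E d)) (hV : RandomCovering.Admissible V)
    (A : Set (RandomCovering.E d)) (hA : AnalyticSet A)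
    (hit : ∀ᵐ ω ∂(RandomCovering.law μ), (A ∩ RandomCovering.coveringSet V ω).Nonempty) :
    ∃ C : Set (RandomCovering.E d), IsCompact C ∧ C ⊆ A ∧
      ∀ᵐ ω ∂(RandomCovering.law μ), (C ∩ RandomCovering.coveringSet V ω).Nonempty := by
  open RandomCovering in
  have := hμ.isProbabilityMeasure
  have := isProbabilityMeasure_onSupport μ
  have := isProbabilityMeasure_law μ
  have : PolishSpace μ.support := Measure.isClosed_support.polishSpace
  let Z : Set (Omega μ × E d) := {p | p.2 ∈ A ∧ p.2 ∈ coveringSet V p.1}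
  have hZ : AnalyticSet Z := by
    have h1 : AnalyticSet (Prod.snd ⁻¹' A : Set (Omega μ × E d)) := hA.preimage continuous_snd
    have h2 : AnalyticSet {p : Omega μ × E d | p.2 ∈ coveringSet V p.1} :=
      (isGδ_graph_coveringSet hV.isOpen).measurableSet.analyticSet
    have h3 : Z = ⋂ b : Bool, cond b (Prod.snd ⁻¹' A : Set (Omega μ × E d))
        {p : Omega μ × E d | p.2 ∈ coveringSet V p.1} := by
      rw [← Set.inter_eq_iInter]
      rfl
    rw [h3]
    exact AnalyticSet.iInter fun b => by cases b <;> assumption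
  have hproj : law μ (Prod.fst '' Z) ≠ 0 := by
    have : ∀ᵐ ω ∂(law μ), ω ∈ Prod.fst '' Z := by
      filter_upwards [hit] with ω ⟨x, hxA, hx⟩
      exact ⟨(ω, x), ⟨hxA, hx⟩, rfl⟩
    rw [measure_congr (eventuallyEq_univ.2 (show Prod.fst '' Z ∈ ae (law μ) from this))]
    simp
  rw [AnalyticSet] at hZ
  rcases hZ with hZ | ⟨g, hg, hgZ⟩
  · simp [hZ] at hproj
  have hgmem : ∀ σ, g σ ∈ Z := fun σ => hgZ ▸ Set.mem_range_self σ
  rw [← hgZ, ← Set.range_comp] at hproj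
  obtain ⟨K, hK, hKpos⟩ :=
    exists_isCompact_measure_image_pos (law μ) (continuous_fst.comp hg) hproj
  refine ⟨(Prod.snd ∘ g) '' K, hK.image (continuous_snd.comp hg), ?_, ?_⟩
  · rintro _ ⟨σ, -, rfl⟩
    exact (hgmem σ).1
  · refine ae_mem_of_tail_invariant (onSupport μ)
      (T := {ω | ((Prod.snd ∘ g) '' K ∩ coveringSet V ω).Nonempty})
      (hK.image (continuous_fst.comp hg)) hKpos ?_ ?_
    · rintro _ ⟨σ, hσ, rfl⟩
      exact ⟨_, ⟨σ, hσ, rfl⟩, (hgmem σ).2⟩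
    · rintro n ω ω' h ⟨x, hxC, hx⟩
      exact ⟨x, hxC, coveringSet_subset_of_tail_eq V n h hx⟩
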